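/- Let $d\ge 1$ and $\boldsymbol\theta=(\theta_1,\dots,\theta_d)$ with all $\theta_k>0$. On $\mathbb R^d$ put $\|x\|_{\boldsymbol\theta}=\big(\sum_k\theta_k^2|x_k|^2\big)^{1/2}$, $G_{\boldsymbol\theta}(x,y)=e^{-\|x-y\|_{\boldsymbol\theta}^2}$, let $\mu_d(dx)=\pi^{-d/2}e^{-\|x\|_2^2}\,dx$, write $\Omega_d$ for the probability space $(\mathbb R^d,\mathcal B_{\mathbb R^d},\mu_d)$, and let $$K_{\boldsymbol\theta}(x,y)=\int_{\mathbb R^d}G_{\boldsymbol\theta}(x,z)G_{\boldsymbol\theta}(y,z)\,\mu_d(dz).$$ For $\theta>0$ and $n\in\mathbb N_0$ put $w_\theta=\frac{2\theta^2}{1+(1+4\theta^2)^{1/2}+2\theta^2}$, $u_\theta=\frac{2\theta^2}{1+(1+4\theta^2)^{1/2}}$, $\rho_{\theta,n}=(1-w_\theta)w_\theta^{n}$, and $$e_{\theta,n}(x)=\Big(\tfrac{(1+4\theta^2)^{1/4}}{2^{n}\,n!}\Big)^{1/2}e^{-u_\theta x^2}H_{n}\big((1+4\theta^2)^{1/4}x\big),\qquad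 H_n(x)=(-1)^ne^{x^2}\tfrac{d^n}{dx^n}e^{-x^2},$$ and for $\boldsymbol n\in\mathbb N_0^d$ let $\phi_{\boldsymbol\theta,\boldsymbol n}(x)=\prod_{k=1}^d\rho_{\theta_k,n_k}e_{\theta_k,n_k}(x_k)$. For $1\le p<\infty$ let $\mathcal B^p_{K_{\boldsymbol\theta}}(\Omega_d)$ be the space of functions $f=\sum_{\boldsymbol n}a_{\boldsymbol n}\phi_{\boldsymbol\theta,\boldsymbol n}$ with $(a_{\boldsymbol n})\in\ell_p$, normed by $\|f\|=\|(a_{\boldsymbol n})\|_p$; let $\mathcal B^\infty_{K_{\boldsymbol\theta}}(\Omega_d)$ be the space of such sums with $(a_{\boldsymbol n})\in c_0$, normed by $\|f\|=\sup_{\boldsymbol n}|a_{\boldsymbol n}|$; and let $\mathcal D$ be the space of such sums with $(a_{\boldsymbol n})\in\ell_\infty$, with the same supremum norm. Let $\mathcal B$ be a Banach space of measurable functions on $\Omega$, let $\mathcal F$ be a normed space of measurable functions on $\Omega'$ which is isometrically isomorphic to the dual space $\mathcal B'$, and let $K:\Omega\times\Omega'\to\mathbb R$ be measurable; write $\langle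 f,g\rangle$ for the value at $f\in\mathcal B$ of the functional on $\mathcal B$ corresponding to $g\in\mathcal F$. Then $\mathcal B$ is a *right-sided reproducing kernel Banach space* with *right-sided reproducing kernel* $K$ (with dual $\mathcal F$) if, for some such isometric isomorphism, $K(x,\cdot)\in\mathcal F$ and $\langle f,K(x,\cdot)\rangle=f(x)$ for all $x\in\Omega$, $f\in\mathcal B$. It is a *two-sided reproducing kernel Banach space* with *two-sided reproducing kernel* $K$ if, for the same isomorphism, also $K(\cdot,y)\in\mathcal B$ and $\langle K(\cdot,y),g\rangle=g(y)$ for all $y\in\Omega'$, $g\in\mathcal F$. **Corollary.** All the above series converge (unconditionally) at every point of $\mathbb R^d$, and the spaces $\mathcal B^p_{K_{\boldsymbol\theta}}(\Omega_d)$, $1\le p\le\infty$, and $\mathcal D$ are well-defined normed spaces of functions. The kernel $K_{\boldsymbol\theta}$ is the right-sided reproducing kernel of the right-sided reproducing kernel Banach space $\mathcal B^1_{K_{\boldsymbol\theta}}(\Omega_d)$ (with dual $\mathcal D$, which contains $\mathcal B^\infty_{K_{\boldsymbol\theta}}(\Omega_d)$ isometrically), and the two-sided reproducing kernel of the two-sided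 reproducing kernel Banach space $\mathcal B^p_{K_{\boldsymbol\theta}}(\Omega_d)$ for every $1<p\le\infty$ (with dual $\mathcal B^q_{K_{\boldsymbol\theta}}(\Omega_d)$, $p^{-1}+q^{-1}=1$). Moreover, $\mathcal B^p_{K_{\boldsymbol\theta}}(\Omega_d)$ consists of continuous functions on $\mathbb R^d$ for all $1\le p\le\infty$. -/

import Mathlib

open Filter Topology MeasureTheory
open scoped ENNReal

noncomputable section

/-! ### Normed spaces of functions and reproducing kernels -/

/-- A real normed space composed of functions on `Ω`: a normed space together with an injective
linear map sending each of its elements to the function it is. -/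
structure NormedFunctionSpace (Ω : Type) where
  /-- the underlying normed space -/
  E : Type
  [normedAddCommGroup : NormedAddCommGroup E]
  [normedSpace : NormedSpace ℝ E]
  /-- the function on `Ω` given by an element of the space -/
  toFun : E →ₗ[ℝ] (Ω → ℝ)
  injective : Function.Injective toFun

attribute [instance] NormedFunctionSpace.normedAddCommGroup NormedFunctionSpace.normedSpace

/-- The set of functions which belong to the space. -/
def NormedFunctionSpace.functions {Ω : Type} (B : NormedFunctionSpace Ω) : Set (Ω → ℝ) :=
  Set.range B.toFun

/-- The standing framework for reproducing properties: `B` is a Banach space of measurable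
functions on `Ω`, `F` is a normed space of measurable functions on `Ω'`, and the kernel `K` is
measurable on `Ω × Ω'`. -/
structure IsReproducingFrame {Ω Ω' : Type} [MeasurableSpace Ω] [MeasurableSpace Ω']
    (B : NormedFunctionSpace Ω) (F : NormedFunctionSpace Ω') (K : Ω → Ω' → ℝ) : Prop where
  complete : CompleteSpace B.E
  measurable_left : ∀ f ∈ B.functions, Measurable f
  measurable_right : ∀ g ∈ F.functions, Measurable g
  measurable_kernel : Measurable (Function.uncurry K)

/-- Under the identification `J` of the function space `F` with the dual space of `B`:
`K(x,·) ∈ F` and `⟨f, K(x,·)⟩ = f(x)` for all `x ∈ Ω` and `f ∈ B`. -/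
def ReproducesRight {Ω Ω' : Type} (B : NormedFunctionSpace Ω) (F : NormedFunctionSpace Ω')
    (J : F.E ≃ₗᵢ[ℝ] StrongDual ℝ B.E) (K : Ω → Ω' → ℝ) : Prop :=
  ∀ x : Ω, ∃ k : F.E, F.toFun k = (fun y => K x y) ∧ ∀ f : B.E, J k f = B.toFun f x

/-- Under the identification `J` of the function space `F` with the dual space of `B`:
`K(·,y) ∈ B` and `⟨K(·,y), g⟩ = g(y)` for all `y ∈ Ω'` and `g ∈ F`. -/
def ReproducesLeft {Ω Ω' : Type} (B : NormedFunctionSpace Ω) (F : NormedFunctionSpace Ω')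
    (J : F.E ≃ₗᵢ[ℝ] StrongDual ℝ B.E) (K : Ω → Ω' → ℝ) : Prop :=
  ∀ y : Ω', ∃ k : B.E, B.toFun k = (fun x => K x y) ∧ ∀ g : F.E, J g k = F.toFun g y

/-- `B` is a right-sided reproducing kernel Banach space with right-sided reproducing kernel `K`,
where the dual space of `B` is isometrically isomorphic to the function space `F`. -/
def IsRightSidedRKBS {Ω Ω' : Type} [MeasurableSpace Ω] [MeasurableSpace Ω']
    (B : NormedFunctionSpace Ω) (F : NormedFunctionSpace Ω') (K : Ω → Ω' → ℝ) : Prop :=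
  IsReproducingFrame B F K ∧ ∃ J : F.E ≃ₗᵢ[ℝ] StrongDual ℝ B.E, ReproducesRight B F J K

/-- `B` is a two-sided reproducing kernel Banach space with two-sided reproducing kernel `K`,
where the dual space of `B` is isometrically isomorphic to the function space `F`. -/
def IsTwoSidedRKBS {Ω Ω' : Type} [MeasurableSpace Ω] [MeasurableSpace Ω']
    (B : NormedFunctionSpace Ω) (F : NormedFunctionSpace Ω') (K : Ω → Ω' → ℝ) : Prop :=
  IsReproducingFrame B F K ∧
    ∃ J : F.E ≃ₗᵢ[ℝ] StrongDual ℝ B.E, ReproducesRight B F J K ∧ ReproducesLeft B F J K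

/-! ### Function spaces spanned by an expansion set -/

/-- `B` is the space of all (pointwise convergent) sums `∑ aₙ φₙ` with coefficient family `a` in
the set `S ⊆ ℓᵖ`, with norm `‖∑ aₙ φₙ‖ = ‖a‖ₚ`. -/
structure IsExpansionSpace {Ω ι : Type} (φ : ι → Ω → ℝ) {p : ℝ≥0∞}
    (S : Set (lp (fun _ : ι => ℝ) p)) (B : NormedFunctionSpace Ω) : Prop where
  summable : ∀ a ∈ S, ∀ x, Summable (fun n => a n * φ n x)
  functions_eq : B.functions = {f | ∃ a ∈ S, ∀ x, HasSum (fun n => a n * φ n x) (f x)}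
  norm_eq : ∀ f : B.E, ∀ a ∈ S, (∀ x, HasSum (fun n => a n * φ n x) (B.toFun f x)) → ‖f‖ = ‖a‖

/-- The coefficient space of the `p`-norm space: `ℓᵖ` if `p < ∞`, and `c₀` if `p = ∞`. -/
def coeffSpace (ι : Type) (p : ℝ≥0∞) : Set (lp (fun _ : ι => ℝ) p) :=
  {a | p = ∞ → Tendsto (fun n => a n) cofinite (𝓝 0)}

/-! ### The integral-type Gaussian kernel -/

/-- The `θ`-norm `(∑ₖ θₖ² |xₖ|²)^{1/2}` on `ℝᵈ`. -/
def thetaNorm {d : ℕ} (θ : Fin d → ℝ) (x : EuclideanSpace ℝ (Fin d)) : ℝ :=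
  Real.sqrt (∑ k, θ k ^ 2 * |x k| ^ 2)

/-- The Gaussian kernel `G_θ(x,y) = exp(-‖x-y‖_θ²)`. -/
def gaussKernel {d : ℕ} (θ : Fin d → ℝ) (x y : EuclideanSpace ℝ (Fin d)) : ℝ :=
  Real.exp (-(thetaNorm θ (x - y)) ^ 2)

/-- The probability measure `μ_d(dx) = π^{-d/2} exp(-‖x‖₂²) dx` on `ℝᵈ`. -/
def gaussMeasure (d : ℕ) : Measure (EuclideanSpace ℝ (Fin d)) :=
  volume.withDensity fun x =>
    ENNReal.ofReal (1 / Real.pi ^ ((d : ℝ) / 2) * Real.exp (-‖x‖ ^ 2))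

/-- The integral-type kernel `K_θ(x,y) = ∫ G_θ(x,z) G_θ(y,z) μ_d(dz)`. -/
def integralGaussKernel {d : ℕ} (θ : Fin d → ℝ) (x y : EuclideanSpace ℝ (Fin d)) : ℝ :=
  ∫ z, gaussKernel θ x z * gaussKernel θ y z ∂(gaussMeasure d)

/-! ### Its expansion set (indices start at `0` instead of `1`) -/

/-- The (physicists') Hermite polynomial `Hₙ(x) = (-1)ⁿ e^{x²} (dⁿ/dxⁿ) e^{-x²}`. -/
def physHermite (n : ℕ) (x : ℝ) : ℝ :=
  (-1) ^ n * Real.exp (x ^ 2) * iteratedDeriv n (fun t : ℝ => Real.exp (-t ^ 2)) x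

/-- `w_θ`. -/
def gaussW (t : ℝ) : ℝ :=
  2 * t ^ 2 / (1 + (1 + 4 * t ^ 2) ^ ((1 : ℝ) / 2) + 2 * t ^ 2)

/-- `u_θ`. -/
def gaussU (t : ℝ) : ℝ :=
  2 * t ^ 2 / (1 + (1 + 4 * t ^ 2) ^ ((1 : ℝ) / 2))

/-- The eigenvalues `(1 - w_θ) w_θⁿ`, `n ≥ 0`, of the univariate Gaussian kernel. -/
def gaussRho (t : ℝ) (n : ℕ) : ℝ :=
  (1 - gaussW t) * gaussW t ^ n

/-- The eigenfunctions of the univariate Gaussian kernel. -/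
def gaussEigenfun (t : ℝ) (n : ℕ) (x : ℝ) : ℝ :=
  ((1 + 4 * t ^ 2) ^ ((1 : ℝ) / 4) / (2 ^ n * (n.factorial : ℝ))) ^ ((1 : ℝ) / 2) *
    Real.exp (-gaussU t * x ^ 2) * physHermite n ((1 + 4 * t ^ 2) ^ ((1 : ℝ) / 4) * x)

/-- The expansion elements `φ_{θ,n}(x) = ∏ₖ ρ_{θₖ,nₖ} e_{θₖ,nₖ}(xₖ)` of `K_θ`, indexed by
multi-indices `n`. -/
def gaussExpansion {d : ℕ} (θ : Fin d → ℝ) (n : Fin d → ℕ) (x : EuclideanSpace ℝ (Fin d)) : ℝ :=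
  ∏ k, gaussRho (θ k) (n k) * gaussEigenfun (θ k) (n k) (x k)

/-- `B` is the space `B^p_{K_θ}(Ω_d)`, for `1 ≤ p ≤ ∞`. -/
def IsGaussSpace {d : ℕ} (θ : Fin d → ℝ) (p : ℝ≥0∞)
    (B : NormedFunctionSpace (EuclideanSpace ℝ (Fin d))) : Prop :=
  IsExpansionSpace (gaussExpansion θ) (coeffSpace (Fin d → ℕ) p) B

/-- `B` is the space of all `∑ₙ bₙ φ_{θ,n}` with bounded coefficients, normed by `supₙ |bₙ|`. -/
def IsBoundedGaussSpace {d : ℕ} (θ : Fin d → ℝ)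
    (B : NormedFunctionSpace (EuclideanSpace ℝ (Fin d))) : Prop :=
  IsExpansionSpace (gaussExpansion θ) (Set.univ : Set (lp (fun _ : Fin d → ℕ => ℝ) ∞)) B

end

/-! Everything reduces to sequence spaces. If `φ` is pointwise absolutely summable and a series `∑
aₙ φₙ` with bounded coefficients vanishes only for `a = 0`, then sending `a` to `∑ aₙ φₙ` identifies
the function spaces with `ℓᵖ` (`c₀` for `p = ∞`), and the dualities `(ℓᵖ)' = ℓ^q`, `(c₀)' = ℓ¹`,
`(ℓ¹)' = ℓ^∞` carry over. If moreover `K(x,y) = ∑ φₙ(x) φₙ(y)`, then `K(x,·)` has coefficient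
sequence `(φₙ(x))ₙ`. This sequence is in `ℓ¹`, hence in all the coefficient spaces, and pairing `a`
with it returns `∑ aₙ φₙ(x)`. This is `exists_rkbs_of_expansionFamily`.

For the Gaussian family, both analytic inputs come from Mehler's formula `hasSum_mehler`. With ratio
`w` on the diagonal it gives `∑ ρₙ eₙ(x)² = 1`, so `|ρₙ eₙ(x)| ≤ √ρₙ` uniformly in `x`; this
geometric majorant yields absolute convergence and continuity. With ratio `w²` it sums `∑ ρₙ² eₙ(x)
eₙ(y)` to the closed form that the Gaussian integral defining `K` also has. Uniqueness of
coefficients follows from Hermite orthogonality, by integrating the series against `gaussTest`. In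
`d` variables all of this factorises over the coordinates. -/

noncomputable section

/-! ### Duality of the sequence spaces -/

section Duality

variable {ι : Type} {p q : ℝ≥0∞}

open Classical in
/-- The coordinate values of a functional on `ℓᵖ`, tested against finitely supported sequences. -/
theorem sum_mul_apply_single_le [Fact (1 ≤ p)] (L : StrongDual ℝ (lp (fun _ : ι => ℝ) p))
    (s : Finset ι) (c : ι → ℝ) :
    ∑ n ∈ s, c n * L (lp.single p n 1) ≤
      ‖L‖ * ‖∑ n ∈ s, lp.single (E := fun _ : ι => ℝ) p n (c n)‖ := by
  have h : ∑ n ∈ s, c n * L (lp.single p n 1) = L (∑ n ∈ s, lp.single p n (c n)) := by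
    rw [map_sum]
    refine Finset.sum_congr rfl fun n _ => ?_
    rw [← smul_eq_mul, ← map_smul, ← lp.single_smul, smul_eq_mul, mul_one]
  rw [h]
  exact (le_abs_self _).trans (L.le_opNorm _)

open Classical in
theorem norm_sum_single_le_one_of_top (s : Finset ι) (c : ι → ℝ) (hc : ∀ n, |c n| ≤ 1) :
    ‖∑ n ∈ s, lp.single (E := fun _ : ι => ℝ) ∞ n (c n)‖ ≤ 1 := by
  refine lp.norm_le_of_forall_le zero_le_one fun i => ?_
  simp only [lp.coeFn_sum, lp.coeFn_single, Finset.sum_apply, Finset.sum_pi_single]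
  split_ifs
  · exact hc i
  · simp

open Classical in
-- Test `L` on a finitely supported sequence of norm at most one: the signs of its coordinate
-- values, weighted for `p < ∞` by an extremal sequence of Hölder's inequality.
theorem sum_norm_rpow_apply_single_le [Fact (1 ≤ p)] [p.HolderConjugate q] (hq : q ≠ ∞)
    (L : StrongDual ℝ (lp (fun _ : ι => ℝ) p)) (s : Finset ι) :
    ∑ n ∈ s, ‖L (lp.single p n 1)‖ ^ q.toReal ≤ ‖L‖ ^ q.toReal := by
  rcases eq_or_ne p ∞ with rfl | hp
  · obtain rfl : q = 1 := ENNReal.HolderConjugate.unique ∞ q 1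
    have h := sum_mul_apply_single_le L s (fun n => SignType.sign (L (lp.single ∞ n 1)))
    have h1 := norm_sum_single_le_one_of_top s
      (fun n => (SignType.sign (L (lp.single ∞ n 1)) : ℝ)) (fun n => by
        rcases lt_trichotomy (L (lp.single ∞ n 1)) 0 with h | h | h <;> simp [h])
    simp only [ENNReal.toReal_one, Real.rpow_one, Real.norm_eq_abs]
    calc ∑ n ∈ s, |L (lp.single ∞ n 1)|
        = ∑ n ∈ s, (SignType.sign (L (lp.single ∞ n 1)) : ℝ) * L (lp.single ∞ n 1) := by
          simp [sign_mul_self]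
      _ ≤ _ := h
      _ ≤ ‖L‖ * 1 := by gcongr
      _ = ‖L‖ := mul_one _
  · have hpq : p.toReal.HolderConjugate q.toReal :=
      ENNReal.HolderConjugate.toReal_of_ne_top hp hq
    -- `g` attains equality in Hölder's inequality on `s`, with `∑ gₙᵖ ≤ 1`.
    obtain ⟨⟨g, hg, hgeq⟩, -⟩ :=
      NNReal.isGreatest_Lp s (fun n => ‖L (lp.single p n 1)‖₊) hpq.symm
    have h := sum_mul_apply_single_le L s
      (fun n => (SignType.sign (L (lp.single p n 1)) : ℝ) * g n)
    have hn : ‖∑ n ∈ s, lp.single (E := fun _ : ι => ℝ) p n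
        ((SignType.sign (L (lp.single p n 1)) : ℝ) * g n)‖ ≤ 1 := by
      rw [← Real.rpow_le_rpow_iff (norm_nonneg _) zero_le_one hpq.pos, lp.norm_sum_single hpq.pos,
        Real.one_rpow]
      have hg' : ∑ n ∈ s, (g n : ℝ) ^ p.toReal ≤ 1 := by exact_mod_cast hg
      refine (Finset.sum_le_sum fun n _ => ?_).trans hg'
      refine Real.rpow_le_rpow (norm_nonneg _) ?_ hpq.nonneg
      rcases lt_trichotomy (L (lp.single p n 1)) 0 with h | h | h <;> simp [h]
    have h2 : ((∑ n ∈ s, ‖L (lp.single p n 1)‖ ^ q.toReal) ^ (1 / q.toReal) : ℝ) ≤ ‖L‖ := by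
      have h3 := congrArg ((↑) : NNReal → ℝ) hgeq
      push_cast at h3
      rw [← h3]
      calc ∑ n ∈ s, ‖L (lp.single p n 1)‖ * (g n : ℝ)
          = ∑ n ∈ s, (SignType.sign (L (lp.single p n 1)) : ℝ) * g n * L (lp.single p n 1) := by
            refine Finset.sum_congr rfl fun n _ => ?_
            rw [mul_right_comm, sign_mul_self, Real.norm_eq_abs]
        _ ≤ _ := h
        _ ≤ ‖L‖ * 1 := by gcongr
        _ = ‖L‖ := mul_one _
    have h0 : 0 ≤ ∑ n ∈ s, ‖L (lp.single p n 1)‖ ^ q.toReal := by positivity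
    have h4 := Real.rpow_le_rpow (by positivity) h2 hpq.symm.nonneg
    rwa [← Real.rpow_mul h0, one_div, inv_mul_cancel₀ hpq.symm.ne_zero, Real.rpow_one] at h4

open Classical in
theorem norm_apply_single_le [Fact (1 ≤ p)] (L : StrongDual ℝ (lp (fun _ : ι => ℝ) p)) (n : ι) :
    ‖L (lp.single p n 1)‖ ≤ ‖L‖ := by
  have := L.le_opNorm (lp.single p n 1)
  rwa [lp.norm_single (zero_lt_one.trans_le Fact.out), norm_one, mul_one] at this

open Classical in
-- For `p = ∞` the sequence `g` need not determine `L` on all of `ℓ^∞`; it does so on `c₀`, which is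
-- all that `coeffDual` needs.
theorem exists_lp_of_dual [Fact (1 ≤ p)] [Fact (1 ≤ q)] [p.HolderConjugate q]
    (L : StrongDual ℝ (lp (fun _ : ι => ℝ) p)) :
    ∃ g : lp (fun _ : ι => ℝ) q, (∀ n, g n = L (lp.single p n 1)) ∧ ‖g‖ ≤ ‖L‖ := by
  rcases eq_or_ne q ∞ with rfl | hq
  · refine ⟨⟨fun n => L (lp.single p n 1), memℓp_infty ⟨‖L‖, ?_⟩⟩, fun n => rfl,
      lp.norm_le_of_forall_le (norm_nonneg _) fun n => norm_apply_single_le L n⟩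
    rintro _ ⟨n, rfl⟩
    exact norm_apply_single_le L n
  · have hq0 : 0 < q.toReal :=
      ENNReal.toReal_pos (zero_lt_one.trans_le Fact.out).ne' hq
    exact ⟨⟨fun n => L (lp.single p n 1), memℓp_gen' (sum_norm_rpow_apply_single_le hq L)⟩,
      fun n => rfl, lp.norm_le_of_forall_sum_le hq0 (norm_nonneg _)
        (sum_norm_rpow_apply_single_le hq L)⟩

/-- The coefficient spaces as submodules of `ℓᵖ`. -/
def coeffSubmodule (ι : Type) (p : ℝ≥0∞) : Submodule ℝ (lp (fun _ : ι => ℝ) p) where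
  carrier := coeffSpace ι p
  add_mem' {a b} ha hb hp := by simpa using (ha hp).add (hb hp)
  zero_mem' hp := by simpa using tendsto_const_nhds
  smul_mem' c a ha hp := by simpa using (ha hp).const_mul c

theorem coeffSubmodule_eq_top (hp : p ≠ ∞) : coeffSubmodule ι p = ⊤ :=
  eq_top_iff.2 fun _ _ h => absurd h hp

theorem isClosed_coeffSubmodule [Fact (1 ≤ p)] :
    IsClosed (coeffSubmodule ι p : Set (lp (fun _ : ι => ℝ) p)) := by
  rcases eq_or_ne p ∞ with rfl | hp
  · refine isClosed_of_closure_subset fun a ha _ => ?_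
    rw [Metric.tendsto_nhds]
    intro ε hε
    obtain ⟨b, hb, hab⟩ := Metric.mem_closure_iff.1 ha (ε / 2) (half_pos hε)
    filter_upwards [Metric.tendsto_nhds.1 (hb rfl) (ε / 2) (half_pos hε)] with n hn
    have h1 := lp.norm_apply_le_norm (by simp) (a - b) n
    rw [dist_eq_norm] at hab
    simp only [lp.coeFn_sub, Pi.sub_apply, Real.norm_eq_abs] at h1
    rw [Real.dist_eq, sub_zero] at hn ⊢
    linarith [abs_sub_abs_le_abs_sub (a n) (b n)]
  · rw [coeffSubmodule_eq_top hp]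
    exact isClosed_univ

open Classical in
-- This is the reason for `c₀` in place of `ℓ^∞`: the tails of `a` become small in norm, so a
-- continuous functional is determined by its values on the unit sequences.
theorem hasSum_single_of_mem_coeffSubmodule [Fact (1 ≤ p)] {a : lp (fun _ : ι => ℝ) p}
    (ha : a ∈ coeffSubmodule ι p) : HasSum (fun n => lp.single p n (a n)) a := by
  rcases eq_or_ne p ∞ with rfl | hp
  · rw [HasSum, SummationFilter.unconditional_filter, Metric.tendsto_atTop]
    intro ε hε
    have h := Metric.tendsto_nhds.1 (ha rfl) (ε / 2) (half_pos hε)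
    refine ⟨h.toFinset, fun s hs => ?_⟩
    rw [dist_eq_norm]
    refine (lp.norm_le_of_forall_le (half_pos hε).le fun i => ?_).trans_lt (half_lt_self hε)
    simp only [lp.coeFn_sub, Pi.sub_apply, lp.coeFn_sum, lp.coeFn_single, Finset.sum_apply,
      Finset.sum_pi_single]
    split_ifs with hi
    · simpa using (half_pos hε).le
    · have : i ∉ h.toFinset := fun hi' => hi (hs hi')
      simp only [Set.Finite.mem_toFinset, Set.mem_compl_iff, Set.mem_ofPred_eq, not_not,
        Real.dist_eq, sub_zero] at this
      simpa using this.le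
  · exact lp.hasSum_single hp a

open Classical in
theorem single_mem_coeffSubmodule (n : ι) (c : ℝ) : lp.single p n c ∈ coeffSubmodule ι p := by
  intro _
  refine tendsto_const_nhds.congr' ?_
  filter_upwards [(Set.finite_singleton n).compl_mem_cofinite] with m hm
  simp [show m ≠ n from hm]

/-- The pairing `⟨a, g⟩ = ∑ aₙ gₙ`, as a map from `ℓ^q` to the dual of the coefficient space. -/
def coeffPairing (ι : Type) (p q : ℝ≥0∞) [Fact (1 ≤ p)] [Fact (1 ≤ q)] [q.HolderConjugate p] :
    lp (fun _ : ι => ℝ) q →L[ℝ] StrongDual ℝ (coeffSubmodule ι p) :=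
  (ContinuousLinearMap.precomp ℝ (coeffSubmodule ι p).subtypeL).comp
    (lp.dualPairing (E := fun _ : ι => ℝ) (F := fun _ : ι => ℝ) q p
      (fun _ => ContinuousLinearMap.mul ℝ ℝ) (K := 1)
      (fun _ => by simp))

theorem coeffPairing_apply [Fact (1 ≤ p)] [Fact (1 ≤ q)] [q.HolderConjugate p]
    (g : lp (fun _ : ι => ℝ) q) (a : coeffSubmodule ι p) :
    coeffPairing ι p q g a = ∑' n, g n * a.1 n := rfl

theorem norm_coeffPairing_apply_le [Fact (1 ≤ p)] [Fact (1 ≤ q)] [q.HolderConjugate p]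
    (g : lp (fun _ : ι => ℝ) q) : ‖coeffPairing ι p q g‖ ≤ ‖g‖ := by
  refine ContinuousLinearMap.opNorm_le_bound _ (norm_nonneg _) fun a => ?_
  have h := lp.norm_dualPairing (E := fun _ : ι => ℝ) (F := fun _ : ι => ℝ) (p := q) (q := p)
      (fun _ => ContinuousLinearMap.mul ℝ ℝ) (K := 1)
      (fun _ => by simp)
  have h2 := (lp.dualPairing (E := fun _ : ι => ℝ) (F := fun _ : ι => ℝ) q p
    (fun _ => ContinuousLinearMap.mul ℝ ℝ) (K := 1) (fun _ => by simp)).le_opNorm₂ g a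
  refine h2.trans (mul_le_mul_of_nonneg_right ?_ (norm_nonneg _))
  exact (mul_le_mul_of_nonneg_right h (norm_nonneg _)).trans_eq (one_mul _)

/-- The dual of the coefficient space `ℓᵖ` (`c₀` if `p = ∞`) is `ℓ^q`. -/
def coeffDual (ι : Type) (p q : ℝ≥0∞) [Fact (1 ≤ p)] [Fact (1 ≤ q)] [q.HolderConjugate p] :
    lp (fun _ : ι => ℝ) q ≃ₗᵢ[ℝ] StrongDual ℝ (coeffSubmodule ι p) := by
  classical
  haveI : p.HolderConjugate q := ENNReal.HolderConjugate.symm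
  exact LinearIsometryEquiv.ofSurjective
    { toLinearMap := (coeffPairing ι p q).toLinearMap
      norm_map' := fun g => by
        refine le_antisymm (norm_coeffPairing_apply_le g) ?_
        -- Hahn–Banach extends the functional from the coefficient space to all of `ℓᵖ` with the
        -- same norm. The coordinate sequence of the extension is `g` again, which bounds `‖g‖` by
        -- the norm of the functional.
        obtain ⟨L, hL, hnorm⟩ := exists_extension_norm_eq _ (coeffPairing ι p q g)
        obtain ⟨g', hg', hle⟩ := exists_lp_of_dual (q := q) L
        have : g' = g := by
          ext n
          have h1 := hL ⟨lp.single p n 1, single_mem_coeffSubmodule n 1⟩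
          rw [hg' n]
          refine h1.trans ?_
          rw [coeffPairing_apply, tsum_eq_single n fun m hm => by simp [hm]]
          simp
        rw [← this]
        refine hle.trans ?_
        rw [hnorm, this]
        rfl }
    (fun L => by
      obtain ⟨L', hL', -⟩ := exists_extension_norm_eq _ L
      obtain ⟨g, hg, -⟩ := exists_lp_of_dual (q := q) L'
      refine ⟨g, ContinuousLinearMap.ext fun a => ?_⟩
      rw [← hL' a]
      refine (coeffPairing_apply g a).trans ?_
      -- Surjectivity: on the coefficient space the extension is recovered from its coordinate
      -- values.
      have h := L'.hasSum (hasSum_single_of_mem_coeffSubmodule a.2)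
      rw [← h.tsum_eq]
      refine tsum_congr fun n => ?_
      rw [hg n, mul_comm, ← smul_eq_mul, ← map_smul, ← lp.single_smul, smul_eq_mul, mul_one])

theorem coeffDual_apply [Fact (1 ≤ p)] [Fact (1 ≤ q)] [q.HolderConjugate p]
    (g : lp (fun _ : ι => ℝ) q) (a : coeffSubmodule ι p) :
    coeffDual ι p q g a = ∑' n, g n * a.1 n := rfl

end Duality

/-! ### Expansion spaces of a summable independent family -/

section Expansion

variable {Ω ι : Type}

/-- A family of functions which is pointwise absolutely summable, and for which a sum with bounded
coefficients vanishes only if the coefficients do. -/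
structure IsExpansionFamily (φ : ι → Ω → ℝ) : Prop where
  summable_abs : ∀ x, Summable fun n => |φ n x|
  eq_zero : ∀ a : ι → ℝ, (∃ C, ∀ n, |a n| ≤ C) → (∀ x, HasSum (fun n => a n * φ n x) 0) → a = 0

variable {φ : ι → Ω → ℝ} {p q : ℝ≥0∞}

theorem IsExpansionFamily.summable_mul (h : IsExpansionFamily φ) {a : ι → ℝ} {C : ℝ}
    (ha : ∀ n, |a n| ≤ C) (x : Ω) : Summable fun n => a n * φ n x := by
  refine Summable.of_norm_bounded ((h.summable_abs x).mul_left C) fun n => ?_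
  rw [Real.norm_eq_abs, abs_mul]
  gcongr
  exact ha n

theorem lp.abs_apply_le [Fact (1 ≤ p)] (a : lp (fun _ : ι => ℝ) p) (n : ι) : |a n| ≤ ‖a‖ :=
  lp.norm_apply_le_norm (zero_lt_one.trans_le Fact.out).ne' a n

/-- The normed function space of all sums `∑ aₙ φₙ` with `a ∈ S`. -/
def expansionSpace (h : IsExpansionFamily φ) [Fact (1 ≤ p)]
    (S : Submodule ℝ (lp (fun _ : ι => ℝ) p)) : NormedFunctionSpace Ω where
  E := S
  toFun :=
    { toFun := fun a x => ∑' n, a.1 n * φ n x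
      map_add' := fun a b => by
        ext x
        rw [Pi.add_apply, ← (h.summable_mul (lp.abs_apply_le a.1) x).tsum_add
          (h.summable_mul (lp.abs_apply_le b.1) x)]
        exact tsum_congr fun n => add_mul _ _ _
      map_smul' := fun c a => by
        ext x
        rw [Pi.smul_apply, smul_eq_mul, ← tsum_mul_left]
        exact tsum_congr fun n => mul_assoc _ _ _ }
  injective := by
    refine (injective_iff_map_eq_zero _).2 fun a ha => Subtype.ext (lp.ext ?_)
    refine h.eq_zero _ ⟨_, lp.abs_apply_le a.1⟩ fun x => ?_
    have := congrFun ha x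
    have h2 := (h.summable_mul (lp.abs_apply_le a.1) x).hasSum
    rwa [show ∑' n, a.1 n * φ n x = 0 from this] at h2

theorem expansionSpace_hasSum (h : IsExpansionFamily φ) [Fact (1 ≤ p)]
    (S : Submodule ℝ (lp (fun _ : ι => ℝ) p)) (a : S) (x : Ω) :
    HasSum (fun n => a.1 n * φ n x) ((expansionSpace h S).toFun a x) :=
  (h.summable_mul (lp.abs_apply_le a.1) x).hasSum

theorem isExpansionSpace_expansionSpace (h : IsExpansionFamily φ) [Fact (1 ≤ p)]
    (S : Submodule ℝ (lp (fun _ : ι => ℝ) p)) :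
    IsExpansionSpace φ (S : Set (lp (fun _ : ι => ℝ) p)) (expansionSpace h S) where
  summable a _ x := h.summable_mul (lp.abs_apply_le a) x
  functions_eq := by
    ext f
    constructor
    · rintro ⟨a, rfl⟩
      exact ⟨a.1, a.2, expansionSpace_hasSum h S a⟩
    · rintro ⟨a, ha, hf⟩
      exact ⟨⟨a, ha⟩, funext fun x => (expansionSpace_hasSum h S ⟨a, ha⟩ x).unique (hf x)⟩
  norm_eq f a ha hf := by
    have : f = (⟨a, ha⟩ : S) := (expansionSpace h S).injective <|
      funext fun x => (hf x).unique (expansionSpace_hasSum h S ⟨a, ha⟩ x)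
    rw [this]
    rfl

/-- The sequence `(φₙ(x))ₙ` as an element of `ℓᵖ`. -/
def evalSeq (h : IsExpansionFamily φ) (p : ℝ≥0∞) [hp : Fact (1 ≤ p)] (x : Ω) :
    lp (fun _ : ι => ℝ) p :=
  -- Absolute summability is membership in `ℓ¹`, which lies in every `ℓᵖ`.
  ⟨fun n => φ n x, (memℓp_gen (p := 1) (by simpa using h.summable_abs x)).of_exponent_ge hp.out⟩

theorem evalSeq_mem (h : IsExpansionFamily φ) (p : ℝ≥0∞) [Fact (1 ≤ p)] (x : Ω) :
    evalSeq h p x ∈ coeffSubmodule ι p := fun _ =>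
  tendsto_zero_iff_abs_tendsto_zero _ |>.2 (h.summable_abs x).tendsto_cofinite_zero

variable {K : Ω → Ω → ℝ}

/-- The coefficients of `K(x,·)` are `φₙ(x)`, so the pairing with them is evaluation at `x`; by
symmetry the same holds on the other side. A general `T = ⊤` covers both `ℓ^∞`, which represents the
dual for `p = 1`, and `coeffSubmodule ι q` with `q < ∞`. -/
theorem exists_reproducing (h : IsExpansionFamily φ)
    (hK : ∀ x y, HasSum (fun n => φ n x * φ n y) (K x y))
    [Fact (1 ≤ p)] [Fact (1 ≤ q)] [q.HolderConjugate p]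
    {T : Submodule ℝ (lp (fun _ : ι => ℝ) q)} (hT : T = ⊤) :
    ∃ J : (expansionSpace h T).E ≃ₗᵢ[ℝ] StrongDual ℝ (expansionSpace h (coeffSubmodule ι p)).E,
      ReproducesRight (expansionSpace h (coeffSubmodule ι p)) (expansionSpace h T) J K ∧
      ReproducesLeft (expansionSpace h (coeffSubmodule ι p)) (expansionSpace h T) J K := by
  refine ⟨(LinearIsometryEquiv.ofTop (R := ℝ) _ T hT).trans (coeffDual ι p q), fun x => ?_,
    fun y => ?_⟩
  · refine ⟨⟨evalSeq h q x, hT ▸ Submodule.mem_top⟩, ?_, fun f => ?_⟩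
    · ext y
      exact (hK x y).tsum_eq
    · refine (coeffDual_apply _ f).trans (tsum_congr fun n => mul_comm _ _)
  · refine ⟨⟨evalSeq h p y, evalSeq_mem h p y⟩, ?_, fun g => ?_⟩
    · ext x
      refine Eq.trans (tsum_congr fun n => mul_comm _ _) (hK x y).tsum_eq
    · exact coeffDual_apply _ _

theorem exists_rkbs_of_expansionFamily [MeasurableSpace Ω] [TopologicalSpace Ω]
    [OpensMeasurableSpace Ω] (h : IsExpansionFamily φ)
    (hK : ∀ x y, HasSum (fun n => φ n x * φ n y) (K x y))
    (hKm : Measurable (Function.uncurry K))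
    (hcont : ∀ a : ι → ℝ, (∃ C, ∀ n, |a n| ≤ C) → Continuous fun x => ∑' n, a n * φ n x) :
    ∃ (B : ℝ≥0∞ → NormedFunctionSpace Ω) (D : NormedFunctionSpace Ω),
      (∀ p : ℝ≥0∞, 1 ≤ p → IsExpansionSpace φ (coeffSpace ι p) (B p)) ∧
      IsExpansionSpace φ (Set.univ : Set (lp (fun _ : ι => ℝ) ∞)) D ∧
      IsRightSidedRKBS (B 1) D K ∧
      (∀ p q : ℝ≥0∞, 1 < p → p.HolderConjugate q → IsTwoSidedRKBS (B p) (B q) K) ∧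
      (∀ p : ℝ≥0∞, 1 ≤ p → ∀ f ∈ (B p).functions, Continuous f) := by
  classical
  have hc : ∀ (p : ℝ≥0∞) [Fact (1 ≤ p)] (S : Submodule ℝ (lp (fun _ : ι => ℝ) p)),
      ∀ f ∈ (expansionSpace h S).functions, Continuous f := by
    rintro p _ S _ ⟨a, rfl⟩
    exact hcont _ ⟨_, lp.abs_apply_le a.1⟩
  have hframe : ∀ (p q : ℝ≥0∞) [Fact (1 ≤ p)] [Fact (1 ≤ q)]
      (T : Submodule ℝ (lp (fun _ : ι => ℝ) q)),
      IsReproducingFrame (expansionSpace h (coeffSubmodule ι p)) (expansionSpace h T) K := by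
    intro p q _ _ T
    exact ⟨isClosed_coeffSubmodule.completeSpace_coe, fun f hf => (hc p _ f hf).measurable,
      fun f hf => (hc q _ f hf).measurable, hKm⟩
  let B : ℝ≥0∞ → NormedFunctionSpace Ω := fun p =>
    if hp : 1 ≤ p then
      haveI : Fact (1 ≤ p) := ⟨hp⟩
      expansionSpace h (coeffSubmodule ι p)
    else expansionSpace h (coeffSubmodule ι 1)
  have hB : ∀ (p : ℝ≥0∞) [hp : Fact (1 ≤ p)], B p = expansionSpace h (coeffSubmodule ι p) :=
    fun p hp => dif_pos hp.out
  refine ⟨B, expansionSpace h (⊤ : Submodule ℝ (lp (fun _ : ι => ℝ) ∞)), fun p hp => ?_,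
    isExpansionSpace_expansionSpace h ⊤, ?_, fun p q hp hpq => ?_, fun p hp => ?_⟩
  · have : Fact (1 ≤ p) := ⟨hp⟩
    rw [hB p]
    exact isExpansionSpace_expansionSpace h (coeffSubmodule ι p)
  · have : (∞ : ℝ≥0∞).HolderConjugate 1 := ENNReal.HolderConjugate.top_one
    rw [hB 1]
    obtain ⟨J, hJ, -⟩ :=
      exists_reproducing (p := 1) h hK (T := (⊤ : Submodule ℝ (lp (fun _ : ι => ℝ) ∞))) rfl
    exact ⟨hframe 1 ∞ ⊤, J, hJ⟩
  · have : Fact (1 ≤ p) := ⟨hp.le⟩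
    have : q.HolderConjugate p := hpq.symm
    have : Fact (1 ≤ q) := ⟨ENNReal.HolderConjugate.one_le q p⟩
    -- As `p > 1`, the conjugate exponent is finite, so the coefficient space for `q` is the whole
    -- of `ℓ^q`.
    have hq : q ≠ ∞ := by
      rintro rfl
      exact hp.ne' (ENNReal.HolderConjugate.unique ∞ p 1)
    rw [hB p, hB q]
    exact ⟨hframe p q _, exists_reproducing h hK (coeffSubmodule_eq_top hq)⟩
  · have : Fact (1 ≤ p) := ⟨hp⟩
    rw [hB p]
    exact hc p _

end Expansion

/-! ### Hermite polynomials -/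

section Hermite

open Polynomial

/-- The physicists' Hermite polynomials, as polynomials. -/
def physHermitePoly : ℕ → ℝ[X]
  | 0 => 1
  | n + 1 => 2 * X * physHermitePoly n - derivative (physHermitePoly n)

theorem hasDerivAt_eval_mul_gauss (P : ℝ[X]) (x : ℝ) :
    HasDerivAt (fun x => P.eval x * Real.exp (-x ^ 2))
      (-((2 * X * P - derivative P).eval x * Real.exp (-x ^ 2))) x := by
  have h1 : HasDerivAt (fun x : ℝ => Real.exp (-x ^ 2)) (Real.exp (-x ^ 2) * -(2 * x)) x := by
    have := ((hasDerivAt_pow 2 x).neg).exp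
    simpa using this
  refine ((P.hasDerivAt x).mul h1).congr_deriv ?_
  simp
  ring

theorem iteratedDeriv_gauss (n : ℕ) :
    iteratedDeriv n (fun t : ℝ => Real.exp (-t ^ 2)) =
      fun x => (-1) ^ n * ((physHermitePoly n).eval x * Real.exp (-x ^ 2)) := by
  induction n with
  | zero => simp [physHermitePoly]
  | succ n ih =>
    rw [iteratedDeriv_succ, ih]
    ext x
    rw [((hasDerivAt_eval_mul_gauss (physHermitePoly n) x).const_mul _).deriv, physHermitePoly]
    ring

theorem physHermite_eq_eval (n : ℕ) (x : ℝ) : physHermite n x = (physHermitePoly n).eval x := by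
  have h1 : ((-1 : ℝ) ^ n) * (-1) ^ n = 1 := by rw [← mul_pow]; simp
  have h2 : Real.exp (x ^ 2) * Real.exp (-x ^ 2) = 1 := by rw [← Real.exp_add]; simp
  rw [physHermite, iteratedDeriv_gauss]
  linear_combination (physHermitePoly n).eval x * (Real.exp (x ^ 2) * Real.exp (-x ^ 2) * h1 + h2)

theorem continuous_physHermite (n : ℕ) : Continuous (physHermite n) := by
  rw [show physHermite n = fun x => (physHermitePoly n).eval x from funext (physHermite_eq_eval n)]
  fun_prop

theorem derivative_physHermitePoly (n : ℕ) :
    derivative (physHermitePoly (n + 1)) = 2 * (n + 1) * physHermitePoly n := by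
  induction n with
  | zero => simp [physHermitePoly]
  | succ n ih =>
    rw [physHermitePoly, derivative_sub, ih]
    have : derivative (2 * ((n : ℝ[X]) + 1) * physHermitePoly n)
        = 2 * ((n : ℝ[X]) + 1) * derivative (physHermitePoly n) := by
      simp [derivative_mul]
    rw [this]
    simp only [derivative_mul, derivative_X, derivative_ofNat, ih]
    rw [physHermitePoly]
    push_cast
    ring

theorem integrable_eval_mul_gauss (P : ℝ[X]) {b : ℝ} (hb : 0 < b) :
    Integrable fun x => P.eval x * Real.exp (-b * x ^ 2) := by
  induction P using Polynomial.induction_on' with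
  | add p q hp hq =>
    simp only [eval_add, add_mul]
    exact hp.add hq
  | monomial n c =>
    have := (integrable_rpow_mul_exp_neg_mul_sq hb (s := n)
      (by linarith [(Nat.cast_nonneg n : (0 : ℝ) ≤ n)])).const_mul c
    simpa [mul_assoc] using this

/-- Integration by parts, since `Hₙ₊₁ e^{-x²}` is minus the derivative of `Hₙ e^{-x²}`.
Integrability of all products removes the boundary terms. -/
theorem integral_physHermitePoly_succ (P : ℝ[X]) (n : ℕ) :
    ∫ x, P.eval x * ((physHermitePoly (n + 1)).eval x * Real.exp (-x ^ 2)) =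
      ∫ x, (derivative P).eval x * ((physHermitePoly n).eval x * Real.exp (-x ^ 2)) := by
  have hint : ∀ P Q : ℝ[X], Integrable fun x => P.eval x * (Q.eval x * Real.exp (-x ^ 2)) := by
    intro P Q
    simpa [mul_assoc] using integrable_eval_mul_gauss (P * Q) one_pos
  have h := integral_mul_deriv_eq_deriv_mul_of_integrable
    (u := fun x => P.eval x) (u' := fun x => (derivative P).eval x)
    (v := fun x => (physHermitePoly n).eval x * Real.exp (-x ^ 2))
    (v' := fun x => -((physHermitePoly (n + 1)).eval x * Real.exp (-x ^ 2)))
    (fun x _ => P.hasDerivAt x) (fun x _ => hasDerivAt_eval_mul_gauss _ x)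
    ((hint P (physHermitePoly (n + 1))).neg.congr (by filter_upwards with x; simp))
    (hint _ _) (hint _ _)
  simp only [mul_neg, integral_neg, neg_inj] at h
  exact h

/-- As `H'ₘ₊₁ = 2(m+1) Hₘ`, each integration by parts lowers both indices by one, until one of them
is `0`. -/
theorem integral_physHermitePoly_mul (m n : ℕ) :
    ∫ x, (physHermitePoly m).eval x * ((physHermitePoly n).eval x * Real.exp (-x ^ 2)) =
      if m = n then 2 ^ n * (n.factorial : ℝ) * √Real.pi else 0 := by
  have h0 : ∀ n, ∫ x, (physHermitePoly 0).eval x *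
      ((physHermitePoly (n + 1)).eval x * Real.exp (-x ^ 2)) = 0 := by
    intro n
    rw [integral_physHermitePoly_succ]
    simp [physHermitePoly]
  induction n generalizing m with
  | zero =>
    rcases m with _ | m
    · simpa [physHermitePoly] using integral_gaussian 1
    · rw [if_neg (by simp), ← h0 m]
      congr 1 with x
      ring
  | succ n ih =>
    rcases m with _ | m
    · rw [h0, if_neg (by simp)]
    · rw [integral_physHermitePoly_succ, derivative_physHermitePoly]
      have : ∀ x : ℝ, (2 * ((m : ℝ[X]) + 1) * physHermitePoly m).eval x *
          ((physHermitePoly n).eval x * Real.exp (-x ^ 2)) = (2 * ((m : ℝ) + 1)) *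
          ((physHermitePoly m).eval x * ((physHermitePoly n).eval x * Real.exp (-x ^ 2))) := by
        intro x
        simp
        ring
      simp_rw [this]
      rw [integral_const_mul, ih]
      by_cases hmn : m = n
      · subst hmn
        simp [Nat.factorial_succ, pow_succ]
        ring
      · simp [hmn]

end Hermite

/-! ### Mehler's formula -/

section Mehler

open Complex FourierTransform

/-- Written as a Fourier transform, the Gaussian has `n`-th derivatives that are Fourier integrals
with an `n`-th power in the integrand. This makes the sum over `n` in Mehler's formula an
exponential series. -/
theorem fourier_gauss :
    𝓕 (fun x : ℝ => (√Real.pi : ℂ) * cexp (-Real.pi * Real.pi * x ^ 2)) =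
      fun t : ℝ => ((Real.exp (-t ^ 2) : ℝ) : ℂ) := by
  have h := fourier_gaussian_pi (b := Real.pi) (by simpa using Real.pi_pos)
  have hpi : (Real.pi : ℂ) ≠ 0 := by exact_mod_cast Real.pi_ne_zero
  have hs : (√Real.pi : ℂ) = (Real.pi : ℂ) ^ (1 / 2 : ℂ) := by
    rw [Real.sqrt_eq_rpow, Complex.ofReal_cpow Real.pi_pos.le]
    norm_num
  ext t
  have h2 := congrFun h t
  rw [Real.fourier_real_eq_integral_exp_smul] at h2 ⊢
  have : ∀ x : ℝ, cexp (↑(-2 * Real.pi * x * t) * I) •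
      ((√Real.pi : ℂ) * cexp (-Real.pi * Real.pi * x ^ 2)) = (√Real.pi : ℂ) *
      (cexp (↑(-2 * Real.pi * x * t) * I) • cexp (-Real.pi * Real.pi * x ^ 2)) := by
    intro x
    simp only [smul_eq_mul]
    ring
  simp_rw [this]
  rw [integral_const_mul, h2, hs, ← mul_assoc,
    mul_one_div_cancel (by simp [Complex.cpow_eq_zero_iff, hpi])]
  rw [neg_div, div_self hpi]
  push_cast
  ring_nf

theorem iteratedDeriv_ofReal_comp {f : ℝ → ℝ} (hf : ContDiff ℝ ⊤ f) (n : ℕ) :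
    iteratedDeriv n (fun x => (f x : ℂ)) = fun x => ((iteratedDeriv n f x : ℝ) : ℂ) := by
  induction n with
  | zero => simp
  | succ n ih =>
    rw [iteratedDeriv_succ, ih]
    ext x
    rw [iteratedDeriv_succ]
    have : DifferentiableAt ℝ (iteratedDeriv n f) x :=
      (hf.differentiable_iteratedDeriv n (by exact_mod_cast WithTop.coe_lt_top _)) x
    exact this.hasDerivAt.ofReal_comp.deriv

theorem physHermite_eq_integral (n : ℕ) (x : ℝ) :
    (physHermite n x : ℂ) = cexp (x ^ 2) * (√Real.pi : ℂ)⁻¹ *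
      ∫ s : ℝ, (2 * I * s) ^ n * cexp (-s ^ 2 - 2 * I * x * s) := by
  have hcd : ContDiff ℝ ⊤ fun t : ℝ => Real.exp (-t ^ 2) := by fun_prop
  have h1 := congrFun (iteratedDeriv_ofReal_comp hcd n) x
  rw [← fourier_gauss, Real.iteratedDeriv_fourier (N := ⊤) (fun n _ => ?_) le_top,
    Real.fourier_real_eq_integral_exp_smul] at h1
  · rw [physHermite]
    push_cast
    rw [← h1]
    set G : ℝ → ℂ := fun s => (2 * I * s) ^ n * cexp (-s ^ 2 - 2 * I * x * s) with hG
    -- The substitution `s ↦ πs` removes the normalisation of the Fourier transform.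
    have h2 : ∀ s : ℝ, cexp (↑(-2 * Real.pi * s * x) * I) • (-2 * Real.pi * I * s) ^ n •
        ((√Real.pi : ℂ) * cexp (-Real.pi * Real.pi * s ^ 2)) =
        (-1) ^ n * (√Real.pi : ℂ) * G (Real.pi * s) := by
      intro s
      simp only [hG, smul_eq_mul]
      rw [sub_eq_add_neg, Complex.exp_add]
      have e1 : (-2 * Real.pi * I * s : ℂ) = (-1) * (2 * I * (Real.pi * s : ℝ)) := by
        push_cast; ring
      rw [e1, mul_pow]
      have e2 : (↑(-2 * Real.pi * s * x) * I : ℂ) = -(2 * I * x * (Real.pi * s : ℝ)) := by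
        push_cast; ring
      have e3 : (-Real.pi * Real.pi * s ^ 2 : ℂ) = -((Real.pi * s : ℝ) : ℂ) ^ 2 := by
        push_cast; ring
      rw [e2, e3]
      ring
    simp_rw [h2]
    rw [integral_const_mul, Measure.integral_comp_mul_left G Real.pi]
    have hpi : (√Real.pi : ℂ) * (√Real.pi : ℂ) = Real.pi := by
      rw [← ofReal_mul, Real.mul_self_sqrt Real.pi_pos.le]
    have hne : (√Real.pi : ℂ) ≠ 0 := by
      exact_mod_cast (Real.sqrt_pos.2 Real.pi_pos).ne'
    have h4 : ((-1 : ℂ) ^ n) * (-1) ^ n = 1 := by rw [← mul_pow]; simp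
    rw [abs_of_pos (inv_pos.2 Real.pi_pos), Complex.real_smul, ofReal_inv, ← hpi, mul_inv]
    have h5 : (√Real.pi : ℂ) * (√Real.pi : ℂ)⁻¹ = 1 := mul_inv_cancel₀ hne
    linear_combination (cexp (x ^ 2) * (√Real.pi : ℂ)⁻¹ * ∫ s, G s) *
      ((√Real.pi : ℂ) * (√Real.pi : ℂ)⁻¹ * h4 + h5)
  · have h := integrable_eval_mul_gauss (Polynomial.X ^ n)
      (b := Real.pi * Real.pi) (mul_pos Real.pi_pos Real.pi_pos)
    refine (h.const_mul (√Real.pi)).mono (by fun_prop) (ae_of_all _ fun s => ?_)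
    simp [Complex.norm_exp, ← ofReal_pow]
    apply le_of_eq; ring

theorem ofReal_sqrt_eq_cpow {a : ℝ} (ha : 0 ≤ a) : (a : ℂ) ^ (1 / 2 : ℂ) = (√a : ℝ) := by
  rw [Real.sqrt_eq_rpow, Complex.ofReal_cpow ha]
  norm_num

/-- The integrand of the Fourier representation of two Hermite functions. -/
def mehlerWeight (x y : ℝ) (z : ℝ × ℝ) : ℂ :=
  cexp (-z.1 ^ 2 - 2 * I * x * z.1) * cexp (-z.2 ^ 2 - 2 * I * y * z.2)

theorem norm_mehlerWeight (x y : ℝ) (z : ℝ × ℝ) :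
    ‖mehlerWeight x y z‖ = Real.exp (-z.1 ^ 2 - z.2 ^ 2) := by
  rw [mehlerWeight, norm_mul, Complex.norm_exp, Complex.norm_exp, ← Real.exp_add]
  congr 1
  simp [← ofReal_pow]
  ring

theorem continuous_mehlerWeight (x y : ℝ) : Continuous (mehlerWeight x y) := by
  unfold mehlerWeight
  fun_prop

/-- By `2|z₁z₂| ≤ z₁² + z₂²`, the Gaussian `exp(-(1-w)(z₁² + z₂²))` is a majorant. The function
itself dominates the exponential series in `hasSum_mehler`. -/
theorem integrable_exp_mul_abs {w : ℝ} (hw0 : 0 ≤ w) (hw1 : w < 1) :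
    Integrable fun z : ℝ × ℝ => Real.exp (2 * w * |z.1 * z.2|) * Real.exp (-z.1 ^ 2 - z.2 ^ 2) := by
  have h1 : Integrable fun x : ℝ => Real.exp (-(1 - w) * x ^ 2) :=
    integrable_exp_neg_mul_sq (sub_pos.2 hw1)
  refine (h1.mul_prod h1).mono (by fun_prop) (ae_of_all _ fun z => ?_)
  simp only [Real.norm_eq_abs, abs_mul, Real.abs_exp]
  rw [← Real.exp_add, ← Real.exp_add]
  apply Real.exp_le_exp.2
  nlinarith [mul_nonneg hw0 (sq_nonneg (|z.1| - |z.2|)), sq_abs z.1, sq_abs z.2]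

/-- Two successive one-dimensional Gaussian integrals; the inner one leaves the quadratic
coefficient `-(1 - w²)` for the outer one. -/
theorem integral_cexp_mul_mehlerWeight {w : ℝ} (hw0 : 0 ≤ w) (hw1 : w < 1) (x y : ℝ) :
    ∫ z : ℝ × ℝ, cexp (-2 * w * z.1 * z.2) * mehlerWeight x y z =
      (Real.pi : ℂ) * (√(1 - w ^ 2) : ℂ)⁻¹ *
        cexp (-y ^ 2 - (x - w * y) ^ 2 / (1 - w ^ 2)) := by
  have hw : 0 < 1 - w ^ 2 := by nlinarith
  have hint : Integrable fun z : ℝ × ℝ => cexp (-2 * w * z.1 * z.2) * mehlerWeight x y z := by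
    refine (integrable_exp_mul_abs hw0 hw1).mono
      ((by fun_prop : Continuous fun z : ℝ × ℝ => cexp (-2 * w * z.1 * z.2)).mul
        (continuous_mehlerWeight x y)).aestronglyMeasurable (ae_of_all _ fun z => ?_)
    rw [norm_mul, norm_mehlerWeight, Complex.norm_exp, norm_mul]
    simp only [Real.norm_eq_abs, Real.abs_exp]
    gcongr
    have : (-2 * w * z.1 * z.2 : ℂ).re = 2 * w * (-(z.1 * z.2)) := by
      simp
      ring
    rw [this]
    gcongr
    exact neg_le_abs _
  rw [Measure.volume_eq_prod] at hint ⊢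
  rw [integral_prod _ hint]
  have h1 : ∀ s : ℝ, ∫ t : ℝ, cexp (-2 * w * s * t) * mehlerWeight x y (s, t) =
      (√Real.pi : ℂ) * cexp (-(1 - w ^ 2 : ℝ) * s ^ 2 + (2 * I * w * y - 2 * I * x) * s + -y ^ 2) := by
    intro s
    have h := integral_cexp_quadratic (b := -1) (by simp) (-2 * w * s - 2 * I * y)
      (-s ^ 2 - 2 * I * x * s)
    rw [neg_neg, div_one, ofReal_sqrt_eq_cpow Real.pi_pos.le] at h
    calc _ = ∫ t : ℝ, cexp (-1 * t ^ 2 + (-2 * w * s - 2 * I * y) * t +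
          (-s ^ 2 - 2 * I * x * s)) := by
          congr 1 with t
          rw [mehlerWeight, ← Complex.exp_add, ← Complex.exp_add]
          congr 1
          ring
      _ = _ := by
          rw [h]
          congr 2
          push_cast
          linear_combination y ^ 2 * I_sq
  simp_rw [h1]
  rw [integral_const_mul]
  have h := integral_cexp_quadratic (b := -(1 - w ^ 2 : ℝ))
    (by rw [← ofReal_neg, ofReal_re]; linarith)
    (2 * I * w * y - 2 * I * x) (-y ^ 2)
  rw [h, neg_neg, ← ofReal_div, ofReal_sqrt_eq_cpow (by positivity), Real.sqrt_div Real.pi_pos.le]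
  have hpi : (√Real.pi : ℂ) * (√Real.pi : ℂ) = Real.pi := by
    rw [← ofReal_mul, Real.mul_self_sqrt Real.pi_pos.le]
  have hne : (1 - w ^ 2 : ℂ) ≠ 0 := by exact_mod_cast hw.ne'
  rw [ofReal_div, ← mul_assoc, mul_div_assoc', hpi, div_eq_mul_inv]
  congr 2
  push_cast
  field_simp
  linear_combination (4 * (w * y - x) ^ 2) * I_sq

/-- Mehler's formula. With the integral representation of both Hermite factors, the `n`-th term
carries `wⁿ (2is)ⁿ (2it)ⁿ / (2ⁿ n!) = (-2wst)ⁿ / n!`. Dominated convergence allows summation under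
the integral, which leaves a Gaussian integral in `(s,t)`. -/
theorem hasSum_mehler {w : ℝ} (hw0 : 0 ≤ w) (hw1 : w < 1) (x y : ℝ) :
    HasSum (fun n : ℕ => w ^ n / (2 ^ n * (n.factorial : ℝ)) * (physHermite n x * physHermite n y))
      ((√(1 - w ^ 2))⁻¹ * Real.exp ((2 * w * x * y - w ^ 2 * (x ^ 2 + y ^ 2)) / (1 - w ^ 2))) := by
  have hw : 0 < 1 - w ^ 2 := by nlinarith
  have hwc : (1 - w ^ 2 : ℂ) ≠ 0 := by exact_mod_cast hw.ne'
  let F : ℕ → ℝ × ℝ → ℂ := fun n z =>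
    (-2 * w * z.1 * z.2) ^ n / (n.factorial : ℂ) * mehlerWeight x y z
  let b : ℕ → ℝ × ℝ → ℝ := fun n z =>
    (2 * w * |z.1 * z.2|) ^ n / (n.factorial : ℝ) * Real.exp (-z.1 ^ 2 - z.2 ^ 2)
  have hb : ∀ z, HasSum (fun n => b n z)
      (Real.exp (2 * w * |z.1 * z.2|) * Real.exp (-z.1 ^ 2 - z.2 ^ 2)) := fun z =>
    HasSum.mul_right _ (by
      rw [Real.exp_eq_exp_ℝ]
      exact NormedSpace.expSeries_div_hasSum_exp _)
  have hF : ∀ z, HasSum (fun n => F n z) (cexp (-2 * w * z.1 * z.2) * mehlerWeight x y z) :=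
    fun z => HasSum.mul_right _ (by
      rw [Complex.exp_eq_exp_ℂ]
      exact NormedSpace.expSeries_div_hasSum_exp _)
  have hmain := hasSum_integral_of_dominated_convergence (μ := volume) (F := F) b
    (fun n => ((by fun_prop : Continuous fun z : ℝ × ℝ =>
      (-2 * w * z.1 * z.2 : ℂ) ^ n / (n.factorial : ℂ)).mul
        (continuous_mehlerWeight x y)).aestronglyMeasurable)
    (fun n => ae_of_all _ fun z => le_of_eq (by
      simp only [F, b]
      rw [norm_mul, norm_mehlerWeight, norm_div, norm_pow]
      simp [abs_of_nonneg hw0, mul_assoc]))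
    (ae_of_all _ fun z => (hb z).summable)
    ((integrable_exp_mul_abs hw0 hw1).congr (ae_of_all _ fun z => ((hb z).tsum_eq).symm))
    (ae_of_all _ hF)
  rw [integral_cexp_mul_mehlerWeight hw0 hw1] at hmain
  have hpi : (√Real.pi : ℂ) * (√Real.pi : ℂ) = Real.pi := by
    rw [← ofReal_mul, Real.mul_self_sqrt Real.pi_pos.le]
  have hpi0 : (√Real.pi : ℂ) ≠ 0 := by
    exact_mod_cast (Real.sqrt_pos.2 Real.pi_pos).ne'
  rw [← Complex.hasSum_ofReal]
  -- The factor collects the constants of the two integral representations, `e^{x²}/√π` and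
  -- `e^{y²}/√π`.
  convert! hmain.mul_left (cexp (x ^ 2) * cexp (y ^ 2) * (Real.pi : ℂ)⁻¹) using 1
  · ext n
    have h1 : ∫ z, F n z = w ^ n / (2 ^ n * (n.factorial : ℂ)) *
        ((∫ s : ℝ, (2 * I * s) ^ n * cexp (-s ^ 2 - 2 * I * x * s)) *
        ∫ t : ℝ, (2 * I * t) ^ n * cexp (-t ^ 2 - 2 * I * y * t)) := by
      rw [← integral_prod_mul, ← integral_const_mul, Measure.volume_eq_prod]
      congr 1 with z
      simp only [F, mehlerWeight]
      have h2 : (-2 * w * z.1 * z.2 : ℂ) ^ n / (n.factorial : ℂ) =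
          w ^ n / (2 ^ n * (n.factorial : ℂ)) * ((2 * I * z.1) ^ n * (2 * I * z.2) ^ n) := by
        rw [← mul_pow, show (2 * I * z.1 * (2 * I * z.2) : ℂ) = 2 * (-2 * z.1 * z.2) by
          linear_combination (4 * z.1 * z.2 : ℂ) * I_sq, mul_pow 2, div_mul_eq_mul_div,
          mul_left_comm, ← mul_pow, mul_div_mul_left _ _ (pow_ne_zero n two_ne_zero)]
        ring_nf
      rw [h2]
      ring
    rw [h1]
    push_cast
    rw [physHermite_eq_integral, physHermite_eq_integral, ← hpi, mul_inv]
    ring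
  · push_cast
    have h3 : cexp ((2 * w * x * y - w ^ 2 * (x ^ 2 + y ^ 2)) / (1 - w ^ 2)) =
        cexp (x ^ 2) * cexp (y ^ 2) * cexp (-y ^ 2 - (x - w * y) ^ 2 / (1 - w ^ 2)) := by
      rw [← Complex.exp_add, ← Complex.exp_add]
      congr 1
      field_simp
      ring
    have h4 : (Real.pi : ℂ)⁻¹ * Real.pi = 1 :=
      inv_mul_cancel₀ (by exact_mod_cast Real.pi_ne_zero)
    rw [h3]
    linear_combination (-(√(1 - w ^ 2) : ℂ)⁻¹ * (cexp (x ^ 2) * cexp (y ^ 2) *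
      cexp (-y ^ 2 - (x - w * y) ^ 2 / (1 - w ^ 2)))) * h4

end Mehler

/-! ### The univariate expansion -/

section Univariate

variable {t : ℝ}

theorem sqrt_one_add_four_mul_sq_gt_one (ht : 0 < t) : 1 < √(1 + 4 * t ^ 2) :=
  Real.lt_sqrt_of_sq_lt (by nlinarith [sq_pos_of_pos ht])

/-- In terms of `s = √(1 + 4t²)` the quantities `t²`, `w` and `u` are all rational, so the later
identities become field computations in `s`. -/
theorem sq_eq_of_sqrt (t : ℝ) : 4 * t ^ 2 = √(1 + 4 * t ^ 2) ^ 2 - 1 := by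
  rw [Real.sq_sqrt (by positivity)]
  ring

theorem gaussU_eq (ht : 0 < t) : gaussU t = (√(1 + 4 * t ^ 2) - 1) / 2 := by
  have h1 := sqrt_one_add_four_mul_sq_gt_one ht
  have h2 := sq_eq_of_sqrt t
  rw [gaussU, ← Real.sqrt_eq_rpow, div_eq_div_iff (by linarith) two_ne_zero]
  linear_combination h2

theorem gaussW_eq (ht : 0 < t) :
    gaussW t = (√(1 + 4 * t ^ 2) - 1) / (√(1 + 4 * t ^ 2) + 1) := by
  have h1 := sqrt_one_add_four_mul_sq_gt_one ht
  have h2 := sq_eq_of_sqrt t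
  rw [gaussW, ← Real.sqrt_eq_rpow, div_eq_div_iff (by positivity) (by linarith)]
  linear_combination h2

theorem gaussW_pos (ht : 0 < t) : 0 < gaussW t := by
  have h1 := sqrt_one_add_four_mul_sq_gt_one ht
  rw [gaussW_eq ht]
  exact div_pos (by linarith) (by linarith)

theorem one_sub_gaussW (ht : 0 < t) : 1 - gaussW t = 2 / (√(1 + 4 * t ^ 2) + 1) := by
  have h1 := sqrt_one_add_four_mul_sq_gt_one ht
  rw [gaussW_eq ht, one_sub_div (by linarith)]
  ring

theorem gaussW_lt_one (ht : 0 < t) : gaussW t < 1 := by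
  have h1 := sqrt_one_add_four_mul_sq_gt_one ht
  have h2 : 0 < 1 - gaussW t := by
    rw [one_sub_gaussW ht]
    exact div_pos two_pos (by linarith)
  linarith

theorem gaussRho_pos (ht : 0 < t) (n : ℕ) : 0 < gaussRho t n :=
  mul_pos (sub_pos.2 (gaussW_lt_one ht)) (pow_pos (gaussW_pos ht) n)

/-- The scaling `(1 + 4 t²)^{1/4}` of the Hermite polynomials. -/
def gaussBeta (t : ℝ) : ℝ := (1 + 4 * t ^ 2) ^ ((1 : ℝ) / 4)

theorem gaussBeta_pos (t : ℝ) : 0 < gaussBeta t := Real.rpow_pos_of_pos (by positivity) _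

theorem gaussBeta_sq (t : ℝ) : gaussBeta t ^ 2 = √(1 + 4 * t ^ 2) := by
  rw [gaussBeta, ← Real.rpow_natCast, ← Real.rpow_mul (by positivity), Real.sqrt_eq_rpow]
  norm_num

theorem gaussEigenfun_mul (t : ℝ) (n : ℕ) (x y : ℝ) :
    gaussEigenfun t n x * gaussEigenfun t n y =
      gaussBeta t * Real.exp (-gaussU t * (x ^ 2 + y ^ 2)) * (1 / (2 ^ n * (n.factorial : ℝ)) *
        (physHermite n (gaussBeta t * x) * physHermite n (gaussBeta t * y))) := by
  have h : ((gaussBeta t / (2 ^ n * (n.factorial : ℝ))) ^ ((1 : ℝ) / 2)) *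
      ((gaussBeta t / (2 ^ n * (n.factorial : ℝ))) ^ ((1 : ℝ) / 2)) =
      gaussBeta t / (2 ^ n * (n.factorial : ℝ)) := by
    rw [← Real.sqrt_eq_rpow, Real.mul_self_sqrt (div_nonneg (gaussBeta_pos t).le (by positivity))]
  rw [gaussEigenfun, gaussEigenfun, mul_add, Real.exp_add]
  change _ * _ * physHermite n (gaussBeta t * x) * (_ * _ * physHermite n (gaussBeta t * y)) = _
  change (gaussBeta t / (2 ^ n * (n.factorial : ℝ))) ^ ((1 : ℝ) / 2) * _ * _ *
    ((gaussBeta t / (2 ^ n * (n.factorial : ℝ))) ^ ((1 : ℝ) / 2) * _ * _) = _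
  linear_combination (Real.exp (-gaussU t * x ^ 2) * Real.exp (-gaussU t * y ^ 2) *
    physHermite n (gaussBeta t * x) * physHermite n (gaussBeta t * y)) * h

/-- The ratio `r` is kept free because it is used twice: `r = w` for the uniform bound, `r = w²` for
the kernel. -/
theorem hasSum_pow_mul_gaussEigenfun (t : ℝ) {r : ℝ} (hr0 : 0 ≤ r) (hr1 : r < 1) (x y : ℝ) :
    HasSum (fun n => r ^ n * (gaussEigenfun t n x * gaussEigenfun t n y))
      (gaussBeta t * (√(1 - r ^ 2))⁻¹ * Real.exp (-gaussU t * (x ^ 2 + y ^ 2) +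
        √(1 + 4 * t ^ 2) * (2 * r * x * y - r ^ 2 * (x ^ 2 + y ^ 2)) / (1 - r ^ 2))) := by
  convert! (hasSum_mehler hr0 hr1 (gaussBeta t * x) (gaussBeta t * y)).mul_left
    (gaussBeta t * Real.exp (-gaussU t * (x ^ 2 + y ^ 2))) using 1
  · ext n
    rw [gaussEigenfun_mul]
    ring
  · rw [Real.exp_add, ← gaussBeta_sq]
    have : gaussBeta t ^ 2 * (2 * r * x * y - r ^ 2 * (x ^ 2 + y ^ 2)) / (1 - r ^ 2) =
      (2 * r * (gaussBeta t * x) * (gaussBeta t * y) -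
        r ^ 2 * ((gaussBeta t * x) ^ 2 + (gaussBeta t * y) ^ 2)) / (1 - r ^ 2) := by ring
    rw [this]
    ring

/-- The perfect square makes the square root in Mehler's formula explicit. -/
theorem one_sub_gaussW_sq (ht : 0 < t) :
    1 - gaussW t ^ 2 = (2 * gaussBeta t / (√(1 + 4 * t ^ 2) + 1)) ^ 2 := by
  have h1 := sqrt_one_add_four_mul_sq_gt_one ht
  rw [gaussW_eq ht, div_pow, div_pow, mul_pow, gaussBeta_sq, one_sub_div (by positivity)]
  ring

theorem hasSum_gaussRho_mul_sq (ht : 0 < t) (x : ℝ) :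
    HasSum (fun n => gaussRho t n * gaussEigenfun t n x ^ 2) 1 := by
  have h1 := sqrt_one_add_four_mul_sq_gt_one ht
  have hb := gaussBeta_pos t
  convert! (hasSum_pow_mul_gaussEigenfun t (gaussW_pos ht).le (gaussW_lt_one ht) x x).mul_left
    (1 - gaussW t) using 1
  · ext n
    rw [gaussRho]
    ring
  -- On the diagonal the exponent cancels, because `u = s w / (1 + w)` with `s = √(1 + 4t²)`.
  · have h2 : -gaussU t * (x ^ 2 + x ^ 2) + √(1 + 4 * t ^ 2) *
        (2 * gaussW t * x * x - gaussW t ^ 2 * (x ^ 2 + x ^ 2)) / (1 - gaussW t ^ 2) = 0 := by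
      rw [one_sub_gaussW_sq ht, gaussU_eq ht, gaussW_eq ht, div_pow _ (_ + 1) 2,
        div_pow (2 * gaussBeta t), mul_pow, gaussBeta_sq]
      have : √(1 + 4 * t ^ 2) + 1 ≠ 0 := by linarith
      field_simp
      ring
    rw [h2, Real.exp_zero, one_sub_gaussW_sq ht, Real.sqrt_sq (by positivity), one_sub_gaussW ht]
    field_simp

/-- A term of a nonnegative series with sum `1` is at most `1`; multiplying `ρₙ eₙ(x)² ≤ 1` by `ρₙ`
gives a bound independent of `x`. -/
theorem abs_gaussRho_mul_gaussEigenfun_le (ht : 0 < t) (n : ℕ) (x : ℝ) :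
    |gaussRho t n * gaussEigenfun t n x| ≤ √(gaussRho t n) := by
  have h := le_hasSum (hasSum_gaussRho_mul_sq ht x) n fun m _ =>
    mul_nonneg (gaussRho_pos ht m).le (sq_nonneg _)
  refine Real.abs_le_sqrt ?_
  nlinarith [gaussRho_pos ht n]

theorem summable_sqrt_gaussRho (ht : 0 < t) : Summable fun n => √(gaussRho t n) := by
  have h : ∀ n, √(gaussRho t n) = √(1 - gaussW t) * √(gaussW t) ^ n := by
    intro n
    rw [gaussRho, Real.sqrt_mul (sub_pos.2 (gaussW_lt_one ht)).le]
    congr 1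
    induction n with
    | zero => simp
    | succ n ih => rw [pow_succ, pow_succ, Real.sqrt_mul (pow_pos (gaussW_pos ht) n).le, ih]
  simp_rw [h]
  refine (summable_geometric_of_lt_one (Real.sqrt_nonneg _) ?_).mul_left _
  rw [Real.sqrt_lt' one_pos]
  simpa using gaussW_lt_one ht

theorem continuous_gaussEigenfun (t : ℝ) (n : ℕ) : Continuous (gaussEigenfun t n) := by
  unfold gaussEigenfun
  have := continuous_physHermite n
  fun_prop

/-- The closed form of the univariate kernel. -/
theorem hasSum_gaussRho_mul_gaussEigenfun (ht : 0 < t) (x y : ℝ) :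
    HasSum (fun n => (gaussRho t n * gaussEigenfun t n x) * (gaussRho t n * gaussEigenfun t n y))
      ((√(1 + 2 * t ^ 2))⁻¹ *
        Real.exp (-t ^ 2 * (x ^ 2 + y ^ 2) + t ^ 4 * (x + y) ^ 2 / (1 + 2 * t ^ 2))) := by
  have h1 := sqrt_one_add_four_mul_sq_gt_one ht
  have hb := gaussBeta_pos t
  have hw := gaussW_pos ht
  have hw1 := gaussW_lt_one ht
  -- Since `ρₙ² = (1 - w)² (w²)ⁿ`, Mehler's formula applies with ratio `w²`.
  convert! (hasSum_pow_mul_gaussEigenfun t (sq_nonneg (gaussW t))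
    (pow_lt_one₀ hw.le hw1 two_ne_zero) x y).mul_left ((1 - gaussW t) ^ 2) using 1
  · ext n
    rw [gaussRho]
    ring
  · have h2 := sq_eq_of_sqrt t
    have hbs := gaussBeta_sq t
    have hu := gaussU_eq ht
    have hwe := gaussW_eq ht
    have h1w := one_sub_gaussW ht
    set s := √(1 + 4 * t ^ 2) with hs
    have hs1 : 0 < s + 1 := by linarith
    have ht2 : t ^ 2 = (s ^ 2 - 1) / 4 := by linarith
    have ht3 : 1 + 2 * t ^ 2 = (s ^ 2 + 1) / 2 := by rw [ht2]; ring
    have h3 : 1 - (gaussW t ^ 2) ^ 2 =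
        (1 + 2 * t ^ 2) * (4 * gaussBeta t / (s + 1) ^ 2) ^ 2 := by
      rw [ht3, div_pow, mul_pow, hbs, hwe]
      field_simp
      ring
    have h4 : gaussBeta t * (√(1 - (gaussW t ^ 2) ^ 2))⁻¹ * (1 - gaussW t) ^ 2 =
        (√(1 + 2 * t ^ 2))⁻¹ := by
      rw [h3, Real.sqrt_mul (by positivity), Real.sqrt_sq (by positivity), h1w]
      field_simp
      norm_num
    have h5 : -t ^ 2 * (x ^ 2 + y ^ 2) + t ^ 4 * (x + y) ^ 2 / (1 + 2 * t ^ 2) =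
        -gaussU t * (x ^ 2 + y ^ 2) + s * (2 * gaussW t ^ 2 * x * y -
          (gaussW t ^ 2) ^ 2 * (x ^ 2 + y ^ 2)) / (1 - (gaussW t ^ 2) ^ 2) := by
      rw [h3, div_pow, mul_pow, hbs, hu, hwe, ht3, show t ^ 4 = (t ^ 2) ^ 2 by ring, ht2]
      have : s ≠ 0 := by linarith
      have : s ^ 2 + 1 ≠ 0 := by positivity
      field_simp
      ring
    rw [h5, ← h4]
    ring

theorem integral_gauss_mul_gauss (t x y : ℝ) :
    ∫ z, Real.exp (-t ^ 2 * (x - z) ^ 2) * Real.exp (-t ^ 2 * (y - z) ^ 2) *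
        ((√Real.pi)⁻¹ * Real.exp (-z ^ 2)) =
      (√(1 + 2 * t ^ 2))⁻¹ *
        Real.exp (-t ^ 2 * (x ^ 2 + y ^ 2) + t ^ 4 * (x + y) ^ 2 / (1 + 2 * t ^ 2)) := by
  have h0 : 0 < 1 + 2 * t ^ 2 := by positivity
  -- Completing the square in `z`; translation invariance then removes the centre.
  have h : ∀ z, Real.exp (-t ^ 2 * (x - z) ^ 2) * Real.exp (-t ^ 2 * (y - z) ^ 2) *
      ((√Real.pi)⁻¹ * Real.exp (-z ^ 2)) = (√Real.pi)⁻¹ *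
        Real.exp (-t ^ 2 * (x ^ 2 + y ^ 2) + t ^ 4 * (x + y) ^ 2 / (1 + 2 * t ^ 2)) *
        Real.exp (-(1 + 2 * t ^ 2) * (z - t ^ 2 * (x + y) / (1 + 2 * t ^ 2)) ^ 2) := by
    intro z
    rw [mul_left_comm, mul_assoc (√Real.pi)⁻¹, ← Real.exp_add, ← Real.exp_add, ← Real.exp_add]
    congr 2
    field_simp
    ring
  simp_rw [h]
  rw [integral_const_mul, integral_sub_right_eq_self
    (fun z => Real.exp (-(1 + 2 * t ^ 2) * z ^ 2)), integral_gaussian, Real.sqrt_div Real.pi_pos.le]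
  have : √Real.pi ≠ 0 := (Real.sqrt_pos.2 Real.pi_pos).ne'
  field_simp

/-- Test functions biorthogonal, up to nonzero factors, to the eigenfunctions. -/
def gaussTest (t : ℝ) (m : ℕ) (x : ℝ) : ℝ :=
  physHermite m (gaussBeta t * x) * Real.exp (gaussU t * x ^ 2 - (gaussBeta t * x) ^ 2)

/-- The growing factor `e^{ux²}` is harmless: with `s = √(1 + 4t²)`, the net decay rate is `s - u =
(s + 1)/2 > 0`. -/
theorem integrable_gaussTest (ht : 0 < t) (m : ℕ) : Integrable (gaussTest t m) := by
  have h1 := sqrt_one_add_four_mul_sq_gt_one ht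
  have hb : 0 < (√(1 + 4 * t ^ 2) + 1) / 2 := by linarith
  refine (integrable_eval_mul_gauss
    ((physHermitePoly m).comp (Polynomial.C (gaussBeta t) * Polynomial.X)) hb).congr
    (ae_of_all _ fun x => ?_)
  simp only [gaussTest, physHermite_eq_eval, Polynomial.eval_comp, Polynomial.eval_mul,
    Polynomial.eval_C, Polynomial.eval_X]
  rw [gaussU_eq ht, mul_pow, gaussBeta_sq]
  congr 2
  ring

/-- The factors `e^{-ux²}` and `e^{ux²}` cancel, which leaves `Hₙ(X) Hₘ(X) e^{-X²}` at `X = βx` with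
`β = gaussBeta t`, and Hermite orthogonality applies. -/
theorem integral_mul_gaussTest (ht : 0 < t) (n m : ℕ) :
    (∫ x, (gaussRho t n * gaussEigenfun t n x) * gaussTest t m x = 0) ↔ n ≠ m := by
  have hb := gaussBeta_pos t
  have h : ∀ x, (gaussRho t n * gaussEigenfun t n x) * gaussTest t m x =
      gaussRho t n * (gaussBeta t / (2 ^ n * (n.factorial : ℝ))) ^ ((1 : ℝ) / 2) *
      (fun X => (physHermitePoly n).eval X * ((physHermitePoly m).eval X * Real.exp (-X ^ 2)))
        (gaussBeta t * x) := by
    intro x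
    have h1 : Real.exp (-(gaussBeta t * x) ^ 2) = Real.exp (-gaussU t * x ^ 2) *
        Real.exp (gaussU t * x ^ 2 - (gaussBeta t * x) ^ 2) := by
      rw [← Real.exp_add]
      congr 1
      ring
    simp only [gaussTest, gaussEigenfun, ← physHermite_eq_eval]
    rw [h1]
    simp only [gaussBeta]
    ring
  simp_rw [h]
  rw [integral_const_mul, Measure.integral_comp_mul_left (fun X => (physHermitePoly n).eval X *
    ((physHermitePoly m).eval X * Real.exp (-X ^ 2))), integral_physHermitePoly_mul]
  have h2 : (gaussBeta t / (2 ^ n * (n.factorial : ℝ))) ^ ((1 : ℝ) / 2) ≠ 0 :=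
    (Real.rpow_pos_of_pos (by positivity) _).ne'
  have h3 : √Real.pi ≠ 0 := (Real.sqrt_pos.2 Real.pi_pos).ne'
  by_cases hnm : n = m
  · subst hnm
    simp only [if_true, ne_eq, not_true_eq_false, iff_false]
    have := (gaussRho_pos ht n).ne'
    have := inv_ne_zero hb.ne'
    positivity
  · simp [hnm]

end Univariate

/-! ### The multivariate expansion -/

section Multivariate

theorem hasSum_mul_prod {ι κ : Type*} {f : ι → ℝ} {g : κ → ℝ} {a b : ℝ} (hf : HasSum f a)
    (hg : HasSum g b) : HasSum (fun p : ι × κ => f p.1 * g p.2) (a * b) :=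
  hf.mul hg (summable_mul_of_summable_norm hf.summable.abs hg.summable.abs)

theorem hasSum_fin_prod {d : ℕ} {f : Fin d → ℕ → ℝ} {S : Fin d → ℝ}
    (h : ∀ k, HasSum (f k) (S k)) :
    HasSum (fun n : Fin d → ℕ => ∏ k, f k (n k)) (∏ k, S k) := by
  induction d with
  | zero => simp [hasSum_unique]
  | succ d ih =>
    rw [← (Fin.consEquiv fun _ : Fin (d + 1) => ℕ).hasSum_iff, Fin.prod_univ_succ]
    have h1 : HasSum (fun n : Fin d → ℕ => ∏ k : Fin d, f k.succ (n k)) (∏ k : Fin d, S k.succ) :=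
      ih (f := fun k => f k.succ) fun k => h k.succ
    convert! hasSum_mul_prod (h 0) h1 using 1
    ext n
    simp [Fin.prod_univ_succ]

variable {d : ℕ} {θ : Fin d → ℝ}

theorem abs_gaussExpansion_le (hθ : ∀ k, 0 < θ k) (n : Fin d → ℕ)
    (x : EuclideanSpace ℝ (Fin d)) :
    |gaussExpansion θ n x| ≤ ∏ k, √(gaussRho (θ k) (n k)) := by
  rw [gaussExpansion, Finset.abs_prod]
  exact Finset.prod_le_prod (fun _ _ => abs_nonneg _) fun k _ =>
    abs_gaussRho_mul_gaussEigenfun_le (hθ k) (n k) (x k)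

theorem summable_prod_sqrt_gaussRho (hθ : ∀ k, 0 < θ k) :
    Summable fun n : Fin d → ℕ => ∏ k, √(gaussRho (θ k) (n k)) :=
  (hasSum_fin_prod fun k => (summable_sqrt_gaussRho (hθ k)).hasSum).summable

theorem continuous_gaussExpansion (θ : Fin d → ℝ) (n : Fin d → ℕ) :
    Continuous (gaussExpansion θ n) := by
  unfold gaussExpansion
  have := fun k => continuous_gaussEigenfun (θ k) (n k)
  fun_prop

theorem norm_mul_gaussExpansion_le (hθ : ∀ k, 0 < θ k) {a : (Fin d → ℕ) → ℝ} {C : ℝ}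
    (ha : ∀ n, |a n| ≤ C) (n : Fin d → ℕ) (x : EuclideanSpace ℝ (Fin d)) :
    ‖a n * gaussExpansion θ n x‖ ≤ C * ∏ k, √(gaussRho (θ k) (n k)) := by
  rw [norm_mul]
  exact mul_le_mul (ha n) (abs_gaussExpansion_le hθ n x) (abs_nonneg _)
    ((abs_nonneg _).trans (ha n))

theorem continuous_tsum_gaussExpansion (hθ : ∀ k, 0 < θ k) {a : (Fin d → ℕ) → ℝ} {C : ℝ}
    (ha : ∀ n, |a n| ≤ C) : Continuous fun x => ∑' n, a n * gaussExpansion θ n x :=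
  continuous_tsum (fun n => (continuous_gaussExpansion θ n).const_mul (a n))
    ((summable_prod_sqrt_gaussRho hθ).mul_left C) (norm_mul_gaussExpansion_le hθ ha)

/-- Integrate the vanishing series against the product `ψ` of test functions with index `m`. The
uniform majorant times `|ψ|` permits termwise integration, each integral factorises over the
coordinates, and only the term `n = m` survives, with a nonzero factor next to `a m`. -/
theorem eq_zero_of_hasSum_gaussExpansion (hθ : ∀ k, 0 < θ k) {a : (Fin d → ℕ) → ℝ} {C : ℝ}
    (ha : ∀ n, |a n| ≤ C) (h0 : ∀ x, HasSum (fun n => a n * gaussExpansion θ n x) 0) : a = 0 := by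
  ext m
  -- Integration takes place on `Fin d → ℝ`, where Lebesgue measure is a product measure.
  let ψ : (Fin d → ℝ) → ℝ := fun x => ∏ k, gaussTest (θ k) (m k) (x k)
  have hψ : Integrable ψ := Integrable.fintype_prod fun k => integrable_gaussTest (hθ k) (m k)
  let F : (Fin d → ℕ) → (Fin d → ℝ) → ℝ := fun n x =>
    a n * gaussExpansion θ n (WithLp.toLp 2 x) * ψ x
  have hFle : ∀ n x, ‖F n x‖ ≤ C * (∏ k, √(gaussRho (θ k) (n k))) * ‖ψ x‖ := fun n x => by
    rw [norm_mul]
    gcongr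
    exact norm_mul_gaussExpansion_le hθ ha n _
  have hFint : ∀ n, Integrable (F n) := fun n => by
    have hc : Continuous fun x : Fin d → ℝ => a n * gaussExpansion θ n (WithLp.toLp 2 x) :=
      ((continuous_gaussExpansion θ n).comp (PiLp.continuous_toLp 2 _)).const_mul (a n)
    exact hψ.bdd_mul hc.aestronglyMeasurable
      (ae_of_all _ fun x => norm_mul_gaussExpansion_le hθ ha n _)
  have hsum := hasSum_integral_of_summable_integral_norm hFint
    (Summable.of_nonneg_of_le (fun n => integral_nonneg fun x => norm_nonneg _)
      (fun n => (integral_mono (hFint n).norm (hψ.norm.const_mul _) (hFle n)).trans_eq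
        (integral_const_mul _ _))
      (((summable_prod_sqrt_gaussRho hθ).mul_left C).mul_right _))
  have hzero : ∀ x, ∑' n, F n x = 0 := fun x => by
    simpa using ((h0 (WithLp.toLp 2 x)).mul_right (ψ x)).tsum_eq
  simp_rw [hzero, integral_zero] at hsum
  have hval : ∀ n, ∫ x, F n x = a n *
      ∏ k, ∫ x, (gaussRho (θ k) (n k) * gaussEigenfun (θ k) (n k) x) * gaussTest (θ k) (m k) x := by
    intro n
    rw [← integral_fintype_prod_volume_eq_prod, ← integral_const_mul]
    congr 1 with x
    simp only [F, ψ, gaussExpansion, mul_assoc, Finset.prod_mul_distrib]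
  have hne : ∀ n, n ≠ m → ∫ x, F n x = 0 := fun n hn => by
    obtain ⟨k, hk⟩ := Function.ne_iff.1 hn
    rw [hval, Finset.prod_eq_zero (Finset.mem_univ k)
      ((integral_mul_gaussTest (hθ k) (n k) (m k)).2 hk), mul_zero]
  have hm := (hasSum_single m hne).unique hsum
  rw [hval] at hm
  refine (mul_eq_zero.1 hm).resolve_right (Finset.prod_ne_zero_iff.2 fun k _ hk => ?_)
  exact (integral_mul_gaussTest (hθ k) (m k) (m k)).1 hk rfl

theorem isExpansionFamily_gaussExpansion (hθ : ∀ k, 0 < θ k) :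
    IsExpansionFamily (gaussExpansion θ) where
  summable_abs x := Summable.of_nonneg_of_le (fun _ => abs_nonneg _)
    (fun n => abs_gaussExpansion_le hθ n x) (summable_prod_sqrt_gaussRho hθ)
  eq_zero _ := fun ⟨_, hC⟩ => eq_zero_of_hasSum_gaussExpansion hθ hC

theorem integralGaussKernel_eq (θ : Fin d → ℝ) (x y : EuclideanSpace ℝ (Fin d)) :
    integralGaussKernel θ x y = ∏ k, (√(1 + 2 * θ k ^ 2))⁻¹ *
      Real.exp (-θ k ^ 2 * (x k ^ 2 + y k ^ 2) +
        θ k ^ 4 * (x k + y k) ^ 2 / (1 + 2 * θ k ^ 2)) := by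
  have hG : ∀ x z : EuclideanSpace ℝ (Fin d),
      gaussKernel θ x z = ∏ k, Real.exp (-θ k ^ 2 * (x k - z k) ^ 2) := by
    intro x z
    rw [gaussKernel, thetaNorm, Real.sq_sqrt (by positivity), ← Real.exp_sum,
      ← Finset.sum_neg_distrib]
    simp
  have hM : ∀ z : EuclideanSpace ℝ (Fin d),
      1 / Real.pi ^ ((d : ℝ) / 2) * Real.exp (-‖z‖ ^ 2) =
        ∏ k, (√Real.pi)⁻¹ * Real.exp (-z k ^ 2) := by
    intro z
    rw [Finset.prod_mul_distrib, ← Real.exp_sum, Finset.sum_neg_distrib, EuclideanSpace.norm_eq,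
      Real.sq_sqrt (by positivity), Finset.prod_const, Finset.card_univ, Fintype.card_fin,
      Real.sqrt_eq_rpow, inv_pow, ← Real.rpow_mul_natCast Real.pi_pos.le, one_div]
    simp only [Real.norm_eq_abs, sq_abs]
    ring_nf
  -- Each closed-form factor is turned back into a one-dimensional integral; Fubini then merges them
  -- into one integral over `ℝᵈ`.
  simp_rw [← integral_gauss_mul_gauss]
  rw [← integral_fintype_prod_volume_eq_prod, integralGaussKernel, gaussMeasure,
    integral_withDensity_eq_integral_toReal_smul (by fun_prop) (by simp),
    ← (PiLp.volume_preserving_toLp (Fin d)).integral_comp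
      (MeasurableEquiv.toLp 2 _).measurableEmbedding]
  congr 1 with z
  rw [ENNReal.toReal_ofReal (by positivity), hM, hG, hG, smul_eq_mul, mul_comm,
    ← Finset.prod_mul_distrib, ← Finset.prod_mul_distrib]

theorem hasSum_gaussExpansion_mul (hθ : ∀ k, 0 < θ k) (x y : EuclideanSpace ℝ (Fin d)) :
    HasSum (fun n => gaussExpansion θ n x * gaussExpansion θ n y) (integralGaussKernel θ x y) := by
  rw [integralGaussKernel_eq]
  simp only [gaussExpansion, ← Finset.prod_mul_distrib]
  exact hasSum_fin_prod (f := fun k n => (gaussRho (θ k) n * gaussEigenfun (θ k) n (x k)) *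
    (gaussRho (θ k) n * gaussEigenfun (θ k) n (y k))) fun k =>
      hasSum_gaussRho_mul_gaussEigenfun (hθ k) (x k) (y k)

theorem measurable_integralGaussKernel (θ : Fin d → ℝ) :
    Measurable (Function.uncurry (integralGaussKernel θ)) := by
  have : Function.uncurry (integralGaussKernel θ) = fun p => ∏ k, (√(1 + 2 * θ k ^ 2))⁻¹ *
      Real.exp (-θ k ^ 2 * (p.1 k ^ 2 + p.2 k ^ 2) +
        θ k ^ 4 * (p.1 k + p.2 k) ^ 2 / (1 + 2 * θ k ^ 2)) :=
    funext fun p => integralGaussKernel_eq θ p.1 p.2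
  rw [this]
  fun_prop

end Multivariate

end

theorem corollaryc (d : ℕ) (hd : 0 < d) (θ : Fin d → ℝ) (hθ : ∀ k, 0 < θ k) :
    ∃ (B : ℝ≥0∞ → NormedFunctionSpace (EuclideanSpace ℝ (Fin d)))
      (D : NormedFunctionSpace (EuclideanSpace ℝ (Fin d))),
      (∀ p : ℝ≥0∞, 1 ≤ p → IsGaussSpace θ p (B p)) ∧
      IsBoundedGaussSpace θ D ∧
      IsRightSidedRKBS (B 1) D (integralGaussKernel θ) ∧
      (∀ p q : ℝ≥0∞, 1 < p → p.HolderConjugate q →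
        IsTwoSidedRKBS (B p) (B q) (integralGaussKernel θ)) ∧
      (∀ p : ℝ≥0∞, 1 ≤ p → ∀ f ∈ (B p).functions, Continuous f) :=
  exists_rkbs_of_expansionFamily (isExpansionFamily_gaussExpansion hθ)
    (hasSum_gaussExpansion_mul hθ) (measurable_integralGaussKernel θ)
    fun _ ⟨_, hC⟩ => continuous_tsum_gaussExpansion hθ hC
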